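/- Let $\mathbb{K}$ be $\mathbb{R}$ or $\mathbb{C}$; all Banach spaces are over $\mathbb{K}$, operators are bounded and linear, and $\mathfrak{L}(X,Y)$ is the space of operators from $X$ to $Y$. $B_X$ denotes the closed unit ball of $X$. Let $X$ be a Banach space and $K\subset X^*$ weak$^*$-compact. For $\varepsilon>0$ let $s_\varepsilon(K)$ be the set of all $x^*\in K$ such that $\operatorname{diam}(V\cap K)>\varepsilon$ (norm diameter) for every weak$^*$-neighborhood $V$ of $x^*$, and let $s_\varepsilon(K)=K$ for $\varepsilon\leqslant 0$. The set $K$ has summable Szlenk index if there is $M\geqslant 0$ such that $\sum_{i=1}^n\varepsilon_i\leqslant M$ whenever $\varepsilon_1,\dots,\varepsilon_n\in\mathbb{R}$ satisfy $s_{\varepsilon_1}\cdots s_{\varepsilon_n}(K)\neq\varnothing$. An operator $A:X\to Y$ has summable Szlenk index if $A^*B_{Y^*}$ does. Put $r_K(x)=\max_{x^*\in K}\operatorname{Re}x^*(x)$ (and $r_\varnothing=0$). For a nonempty directed set $D$ and $n\geqslant 1$ put $D^{\leqslant n}=\bigcup_{i=1}^nD^i$, and for $t=(u_1,\dots,u_k)$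 and $i\leqslant k$ put $t|_i=(u_1,\dots,u_i)$. A collection $(x_t)_{t\in D^{\leqslant n}}\subset X$ is weakly null if for every $t\in\{\varnothing\}\cup D^{\leqslant n-1}$ (with $D^{\leqslant 0}=\varnothing$) the net $(x_{t\smallfrown u})_{u\in D}$ tends weakly to $0$. Let $\Sigma_n(K)$ be the infimum of those $s>0$ such that $$\inf_{t\in D^n}r_K\Bigl(\sum_{i=1}^nx_{t|_i}\Bigr)\leqslant s$$ for every nonempty directed set $D$ and every weakly null $(x_t)_{t\in D^{\leqslant n}}\subset B_X$. Let $\Sigma(K)=\sup_{n\geqslant 1}\Sigma_n(K)\in[0,\infty]$, and $\Sigma(A)=\Sigma(A^*B_{Y^*})$ for an operator $A:X\to Y$. Let $\mathfrak{S}$ be the class of all operators with summable Szlenk index, $\mathfrak{S}(X,Y)=\mathfrak{S}\cap\mathfrak{L}(X,Y)$, and $\mathfrak{s}(A)=\|A\|+\Sigma(A)$. **Theorem.** $(\mathfrak{S},\mathfrak{s})$ is a Banach ideal. That is, for all Banach spaces $W,X,Y,Z$: 1. ($\mathfrak{S}$ is an operator ideal) $ABC\in\mathfrak{S}(W,Z)$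 for all $C\in\mathfrak{L}(W,X)$, $B\in\mathfrak{S}(X,Y)$, $A\in\mathfrak{L}(Y,Z)$; the identity $I_{\mathbb{K}}$ belongs to $\mathfrak{S}$; and $\mathfrak{S}(X,Y)$ is a vector subspace of $\mathfrak{L}(X,Y)$. 2. ($\mathfrak{s}$ is an ideal norm) $\mathfrak{s}$ is finite on $\mathfrak{S}$ and is a norm on $\mathfrak{S}(X,Y)$; $\mathfrak{s}(ABC)\leqslant\|A\|\,\mathfrak{s}(B)\,\|C\|$ for all $C\in\mathfrak{L}(W,X)$, $B\in\mathfrak{S}(X,Y)$, $A\in\mathfrak{L}(Y,Z)$; and for $x^*\in X^*$ and $y\in Y$ the operator $x^*\otimes y:x\mapsto x^*(x)\,y$ satisfies $\mathfrak{s}(x^*\otimes y)=\|x^*\|\,\|y\|$. 3. (completeness) $(\mathfrak{S}(X,Y),\mathfrak{s})$ is complete. -/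

import Mathlib

open Filter Topology
open scoped ENNReal

universe u

/-! ## The Szlenk derivation and summable Szlenk index -/

section Szlenk

variable {𝕜 X : Type*} [RCLike 𝕜] [NormedAddCommGroup X] [NormedSpace 𝕜 X]

/-- The derivation `s_ε` on subsets of `X*`. For `ε > 0`, `s_ε(K)` is the set of those `f ∈ K` all
of whose weak* neighbourhoods `V` satisfy `diam (V ∩ K) > ε`, the diameter being that of the dual
norm; `s_ε(K) = K` for `ε ≤ 0`. -/
def szlenkDeriv (ε : ℝ) (K : Set (WeakDual 𝕜 X)) : Set (WeakDual 𝕜 X) :=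
  {f | f ∈ K ∧ (0 < ε → ∀ V ∈ 𝓝 f,
    ENNReal.ofReal ε < Metric.ediam (WeakDual.toStrongDual '' (V ∩ K)))}

/-- `K` has `M`-summable Szlenk index: `s_{ε₁} s_{ε₂} ⋯ s_{εₙ}(K) ≠ ∅` implies `∑ εᵢ ≤ M`. The finite
sequence `ε₁, …, εₙ` is a list, and `s_{εₙ}` is applied first. -/
def HasSummableSzlenkWith (M : ℝ) (K : Set (WeakDual 𝕜 X)) : Prop :=
  ∀ εs : List ℝ, (εs.foldr szlenkDeriv K).Nonempty → εs.sum ≤ M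

/-- `K` has summable Szlenk index. -/
def HasSummableSzlenk (K : Set (WeakDual 𝕜 X)) : Prop :=
  ∃ M : ℝ, 0 ≤ M ∧ HasSummableSzlenkWith M K

/-! ## The quantity `Σ` -/

/-- `r_K(x) = max_{f ∈ K} Re f(x)` for weak*-compact nonempty `K`, and `r_∅ = 0` (as
`sSup ∅ = 0` in `ℝ`). -/
noncomputable def supportFn (K : Set (WeakDual 𝕜 X)) (x : X) : ℝ :=
  sSup ((fun f : WeakDual 𝕜 X => RCLike.re (f x)) '' K)

variable (𝕜) in
/-- A collection `(x_t)` indexed by the nonempty finite sequences of length at most `n` in `D` is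
weakly null: for every sequence `t` of length less than `n` (the empty one included), the net
`(x_{t⌢d})_{d ∈ D}` tends weakly to `0`. Collections are functions on all lists; their values at
the empty list and at lists of length greater than `n` are never used. -/
def IsWeaklyNullTree {D : Type*} [Preorder D] (n : ℕ) (x : List D → X) : Prop :=
  ∀ t : List D, t.length < n →
    Tendsto (fun d : D => toWeakSpace 𝕜 X (x (t ++ [d]))) atTop (𝓝 0)

/-- The collection `(x_t)`, over the nonempty sequences of length at most `n`, lies in the closed
unit ball. -/
def IsUnitBallTree {D : Type*} (n : ℕ) (x : List D → X) : Prop :=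
  ∀ t : List D, 1 ≤ t.length → t.length ≤ n → ‖x t‖ ≤ 1

end Szlenk

section Sigma

variable {𝕜 : Type*} {X : Type u} [RCLike 𝕜] [NormedAddCommGroup X] [NormedSpace 𝕜 X]

/-- `Σ_n(K)`: the infimum of the `s > 0` such that `inf_{t ∈ Dⁿ} r_K(∑_{i=1}^n x_{t|i}) ≤ s` for
every (nonempty) directed set `D` and every weakly null collection `(x_t)` in the unit ball indexed
by the nonempty sequences of length at most `n` in `D`. The directed sets range over the universe
of `X`, which contains the weak neighbourhood bases of `0` in `X`. -/
noncomputable def sigmaN (n : ℕ) (K : Set (WeakDual 𝕜 X)) : ℝ≥0∞ :=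
  sInf {s : ℝ≥0∞ | ∃ s' : ℝ, 0 < s' ∧ s = ENNReal.ofReal s' ∧
    ∀ (D : Type u) [Preorder D] [IsDirectedOrder D] [Nonempty D] (x : List D → X),
      IsUnitBallTree n x → IsWeaklyNullTree 𝕜 n x →
        ⨅ t : {t : List D // t.length = n},
          supportFn K (∑ i ∈ Finset.Icc 1 n, x (t.1.take i)) ≤ s'}

/-- `Σ(K) = sup_{n ≥ 1} Σ_n(K)`. -/
noncomputable def sigma (K : Set (WeakDual 𝕜 X)) : ℝ≥0∞ :=
  ⨆ (n : ℕ) (_ : 1 ≤ n), sigmaN n K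

end Sigma

section Operator

variable {𝕜 X Y : Type*} [RCLike 𝕜] [NormedAddCommGroup X] [NormedSpace 𝕜 X]
  [NormedAddCommGroup Y] [NormedSpace 𝕜 Y]

/-- The set `A* B_{Y*} ⊆ X*`, the image of the closed dual unit ball under the adjoint of `A`. -/
def adjointBall (A : X →L[𝕜] Y) : Set (WeakDual 𝕜 X) :=
  (fun g : StrongDual 𝕜 Y => StrongDual.toWeakDual (g.comp A)) '' Metric.closedBall 0 1

end Operator

/-! ## Operator ideals -/

/-- A class of operators between Banach spaces over `𝕜`, given through its components
`I(X, Y) ⊆ L(X, Y)`. -/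
abbrev OperatorClass (𝕜 : Type) [RCLike 𝕜] : Type (u + 1) :=
  ∀ (X Y : Type u) [NormedAddCommGroup X] [NormedSpace 𝕜 X] [CompleteSpace X]
    [NormedAddCommGroup Y] [NormedSpace 𝕜 Y] [CompleteSpace Y], Set (X →L[𝕜] Y)

/-- An assignment of a value in `[0, ∞]` to every operator between Banach spaces over `𝕜`. -/
abbrev OperatorFunctional (𝕜 : Type) [RCLike 𝕜] : Type (u + 1) :=
  ∀ (X Y : Type u) [NormedAddCommGroup X] [NormedSpace 𝕜 X] [CompleteSpace X]
    [NormedAddCommGroup Y] [NormedSpace 𝕜 Y] [CompleteSpace Y], (X →L[𝕜] Y) → ℝ≥0∞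

section Ideal

variable {𝕜 : Type} [RCLike 𝕜]

/-- The class `I` is an operator ideal. In `id_mem`, `ULift 𝕜` is the Banach space `𝕜`, placed in
the universe of the spaces under consideration. -/
structure IsOperatorIdeal (I : OperatorClass.{u} 𝕜) : Prop where
  comp_mem : ∀ (W X Y Z : Type u)
    [NormedAddCommGroup W] [NormedSpace 𝕜 W] [CompleteSpace W]
    [NormedAddCommGroup X] [NormedSpace 𝕜 X] [CompleteSpace X]
    [NormedAddCommGroup Y] [NormedSpace 𝕜 Y] [CompleteSpace Y]
    [NormedAddCommGroup Z] [NormedSpace 𝕜 Z] [CompleteSpace Z]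
    (C : W →L[𝕜] X) (B : X →L[𝕜] Y) (A : Y →L[𝕜] Z), B ∈ I X Y → A ∘L B ∘L C ∈ I W Z
  id_mem : ContinuousLinearMap.id 𝕜 (ULift.{u} 𝕜) ∈ I (ULift.{u} 𝕜) (ULift.{u} 𝕜)
  zero_mem : ∀ (X Y : Type u)
    [NormedAddCommGroup X] [NormedSpace 𝕜 X] [CompleteSpace X]
    [NormedAddCommGroup Y] [NormedSpace 𝕜 Y] [CompleteSpace Y], 0 ∈ I X Y
  add_mem : ∀ (X Y : Type u)
    [NormedAddCommGroup X] [NormedSpace 𝕜 X] [CompleteSpace X]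
    [NormedAddCommGroup Y] [NormedSpace 𝕜 Y] [CompleteSpace Y]
    (A B : X →L[𝕜] Y), A ∈ I X Y → B ∈ I X Y → A + B ∈ I X Y
  smul_mem : ∀ (X Y : Type u)
    [NormedAddCommGroup X] [NormedSpace 𝕜 X] [CompleteSpace X]
    [NormedAddCommGroup Y] [NormedSpace 𝕜 Y] [CompleteSpace Y]
    (c : 𝕜) (A : X →L[𝕜] Y), A ∈ I X Y → c • A ∈ I X Y

/-- `ι` is an ideal norm on `I`: it is finite on `I`, is a norm on each component `I(X, Y)`, satisfies
`ι(ABC) ≤ ‖A‖ ι(B) ‖C‖` for `B` in `I`, and `ι(f ⊗ y) = ‖f‖ ‖y‖` for rank-one operators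
`f ⊗ y : x ↦ f(x) y`. -/
structure IsIdealNorm (I : OperatorClass.{u} 𝕜) (ι : OperatorFunctional.{u} 𝕜) : Prop where
  lt_top : ∀ (X Y : Type u)
    [NormedAddCommGroup X] [NormedSpace 𝕜 X] [CompleteSpace X]
    [NormedAddCommGroup Y] [NormedSpace 𝕜 Y] [CompleteSpace Y]
    (A : X →L[𝕜] Y), A ∈ I X Y → ι X Y A < ∞
  eq_zero_iff : ∀ (X Y : Type u)
    [NormedAddCommGroup X] [NormedSpace 𝕜 X] [CompleteSpace X]
    [NormedAddCommGroup Y] [NormedSpace 𝕜 Y] [CompleteSpace Y]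
    (A : X →L[𝕜] Y), A ∈ I X Y → (ι X Y A = 0 ↔ A = 0)
  add_le : ∀ (X Y : Type u)
    [NormedAddCommGroup X] [NormedSpace 𝕜 X] [CompleteSpace X]
    [NormedAddCommGroup Y] [NormedSpace 𝕜 Y] [CompleteSpace Y]
    (A B : X →L[𝕜] Y), A ∈ I X Y → B ∈ I X Y → ι X Y (A + B) ≤ ι X Y A + ι X Y B
  smul_eq : ∀ (X Y : Type u)
    [NormedAddCommGroup X] [NormedSpace 𝕜 X] [CompleteSpace X]
    [NormedAddCommGroup Y] [NormedSpace 𝕜 Y] [CompleteSpace Y]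
    (c : 𝕜) (A : X →L[𝕜] Y), A ∈ I X Y → ι X Y (c • A) = ‖c‖ₑ * ι X Y A
  comp_le : ∀ (W X Y Z : Type u)
    [NormedAddCommGroup W] [NormedSpace 𝕜 W] [CompleteSpace W]
    [NormedAddCommGroup X] [NormedSpace 𝕜 X] [CompleteSpace X]
    [NormedAddCommGroup Y] [NormedSpace 𝕜 Y] [CompleteSpace Y]
    [NormedAddCommGroup Z] [NormedSpace 𝕜 Z] [CompleteSpace Z]
    (C : W →L[𝕜] X) (B : X →L[𝕜] Y) (A : Y →L[𝕜] Z), B ∈ I X Y →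
      ι W Z (A ∘L B ∘L C) ≤ ‖A‖ₑ * ι X Y B * ‖C‖ₑ
  rankOne : ∀ (X Y : Type u)
    [NormedAddCommGroup X] [NormedSpace 𝕜 X] [CompleteSpace X]
    [NormedAddCommGroup Y] [NormedSpace 𝕜 Y] [CompleteSpace Y]
    (f : StrongDual 𝕜 X) (y : Y), ι X Y (ContinuousLinearMap.smulRight f y) = ‖f‖ₑ * ‖y‖ₑ

/-- `(I, ι)` is a Banach ideal: `I` is an operator ideal, `ι` is an ideal norm on `I`, and every
component `(I(X, Y), ι)` is complete. -/
structure IsBanachIdeal (I : OperatorClass.{u} 𝕜) (ι : OperatorFunctional.{u} 𝕜) : Prop where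
  isOperatorIdeal : IsOperatorIdeal I
  isIdealNorm : IsIdealNorm I ι
  complete : ∀ (X Y : Type u)
    [NormedAddCommGroup X] [NormedSpace 𝕜 X] [CompleteSpace X]
    [NormedAddCommGroup Y] [NormedSpace 𝕜 Y] [CompleteSpace Y]
    (A : ℕ → X →L[𝕜] Y), (∀ k, A k ∈ I X Y) →
      (∀ δ : ℝ≥0∞, 0 < δ → ∃ N : ℕ, ∀ j ≥ N, ∀ k ≥ N, ι X Y (A j - A k) < δ) →
      ∃ B ∈ I X Y, Tendsto (fun k => ι X Y (A k - B)) atTop (𝓝 0)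

end Ideal

/-- The class `𝔖` of operators `A : X → Y` with summable Szlenk index, that is, such that
`A* B_{Y*}` has summable Szlenk index. -/
def summableSzlenkClass (𝕜 : Type) [RCLike 𝕜] : OperatorClass.{u} 𝕜 :=
  fun _ _ _ _ _ _ _ _ => {A | HasSummableSzlenk (adjointBall A)}

/-- `𝔰(A) = ‖A‖ + Σ(A)`, where `Σ(A) = Σ(A* B_{Y*})`. -/
noncomputable def sNorm (𝕜 : Type) [RCLike 𝕜] : OperatorFunctional.{u} 𝕜 :=
  fun _ _ _ _ _ _ _ _ A => ‖A‖ₑ + sigma (adjointBall A)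

/-!
The weak neighbourhoods of `0` in `X`, traced on the closed unit ball, form a filter `weakNull 𝕜 X`.
A weakly null tree of height `n` in the ball is a strategy for choosing `n` vectors in turn, called
moves below, each frequently available along this filter. Hence `Σ_n(K) ≤ s` is, up to arbitrarily
small changes of `s`, the iterated statement `∀ᶠ y₁, …, ∀ᶠ yₙ, r_K(y₁ + ⋯ + yₙ) ≤ s`
(`EventuallySum`); one direction passes down the tree (`EventuallySum.exists_branch`), the other
builds a tree indexed by the members of the filter (`exists_tree_of_not_eventuallySum`). For
`K = A* B_{Y*}` one has `r_K(x) = ‖A x‖`, and in the iterated form (`sigma_le_ofReal_iff`) the following are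
immediate: `Σ` is subadditive because eventual statements can be intersected; it behaves well under
composition because operators of norm at most one preserve weakly null moves; it vanishes on
rank-one operators; and it is lower semicontinuous for the operator norm, because a sum of `n` moves
has norm at most `n`.

It remains to show that `A` has summable Szlenk index if and only if `Σ(A) < ∞`
(`hasSummableSzlenk_adjointBall_iff`).

If `s_{ε₁} ⋯ s_{εₙ}(K)` is nonempty, then moves `y₁, …, yₙ` can frequently be chosen together with
functionals in the successive derived sets, the last of them in `K`, so that each step gains about
`εᵢ / 4` (`frequently_lt_re_of_mem_szlenkDeriv`). The moves are half differences of norming vectors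
for functionals far from the current one; along an ultrafilter such vectors are weakly Cauchy. Hence
`∑ εᵢ ≤ 4 Σ(A)`, roughly.

Conversely, if `r_K(y₁ + ⋯ + yₙ) > s` frequently, choose functionals in `K` witnessing this and take
weak* limits from the last move back to the first. If the gain in a move is about `g`, the limit
lies in the derived set `s_g`, up to a small loss (`exists_mem_szlenkDeriv_of_frequently`), and
rounding the gains to a finite grid makes them depend on the number of the move only
(`exists_mem_foldr_szlenkDeriv`). The gains add up to nearly `s`, so `Σ(A) ≤ M` if `K` has
`M`-summable Szlenk index.
-/

/-! ### Iterated eventual quantifiers along the weakly null filter -/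

section WeakNull

variable {𝕜 X Y : Type*} [RCLike 𝕜] [NormedAddCommGroup X] [NormedSpace 𝕜 X]
  [NormedAddCommGroup Y] [NormedSpace 𝕜 Y]

variable (𝕜 X) in
/-- The trace on the closed unit ball of the filter of weak neighbourhoods of `0`. -/
noncomputable def weakNull : Filter X :=
  comap (toWeakSpace 𝕜 X) (𝓝 0) ⊓ 𝓟 (Metric.closedBall 0 1)

theorem tendsto_toWeakSpace_zero_iff {α : Type*} {l : Filter α} {g : α → X} :
    Tendsto (fun a => toWeakSpace 𝕜 X (g a)) l (𝓝 0) ↔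
      ∀ φ : StrongDual 𝕜 X, Tendsto (fun a => φ (g a)) l (𝓝 0) := by
  have h : IsInducing (fun (x : WeakSpace 𝕜 X) (φ : StrongDual 𝕜 X) =>
      (topDualPairing 𝕜 X).flip x φ) := ⟨rfl⟩
  rw [h.tendsto_nhds_iff, tendsto_pi_nhds]
  refine forall_congr' fun φ => ?_
  have h0 : (topDualPairing 𝕜 X).flip (0 : WeakSpace 𝕜 X) φ = 0 := φ.map_zero
  rw [h0]
  rfl

theorem tendsto_weakNull_iff {α : Type*} {l : Filter α} {g : α → X} :
    Tendsto g l (weakNull 𝕜 X) ↔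
      (∀ φ : StrongDual 𝕜 X, Tendsto (fun a => φ (g a)) l (𝓝 0)) ∧ ∀ᶠ a in l, ‖g a‖ ≤ 1 := by
  rw [weakNull, tendsto_inf, tendsto_comap_iff, tendsto_principal]
  simp only [mem_closedBall_zero_iff]
  exact and_congr_left fun _ => tendsto_toWeakSpace_zero_iff

theorem tendsto_apply_weakNull (φ : StrongDual 𝕜 X) : Tendsto φ (weakNull 𝕜 X) (𝓝 0) :=
  (tendsto_weakNull_iff.1 tendsto_id).1 φ

theorem eventually_norm_le_weakNull : ∀ᶠ y in weakNull 𝕜 X, ‖y‖ ≤ 1 :=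
  (tendsto_weakNull_iff.1 tendsto_id).2

theorem pure_zero_le_weakNull : pure 0 ≤ weakNull 𝕜 X :=
  tendsto_id'.1 (tendsto_weakNull_iff.2 ⟨fun φ => by
    simpa using tendsto_pure_nhds φ (0 : X), by simp⟩)

instance : (weakNull 𝕜 X).NeBot := neBot_of_le pure_zero_le_weakNull

theorem tendsto_weakNull_of_norm_le_one {T : X →L[𝕜] Y} (hT : ‖T‖ ≤ 1) :
    Tendsto T (weakNull 𝕜 X) (weakNull 𝕜 Y) :=
  tendsto_weakNull_iff.2 ⟨fun φ => tendsto_apply_weakNull (φ.comp T),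
    eventually_norm_le_weakNull.mono fun _ hy => (T.le_of_opNorm_le hT _).trans (by simpa using hy)⟩

end WeakNull

section EventuallySum

variable {X Y : Type*} [AddCommMonoid X] [AddCommMonoid Y] {l : Filter X} {P Q : X → Prop}

/-- `EventuallySum l n P v` says that `∀ᶠ y₁ in l, …, ∀ᶠ yₙ in l, P (v + y₁ + ⋯ + yₙ)`. -/
def EventuallySum (l : Filter X) : ℕ → (X → Prop) → X → Prop
  | 0, P, v => P v
  | n + 1, P, v => ∀ᶠ y in l, EventuallySum l n P (v + y)

theorem EventuallySum.mp {n : ℕ} {v : X} (hP : EventuallySum l n P v)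
    (h : EventuallySum l n (fun x => P x → Q x) v) : EventuallySum l n Q v := by
  induction n generalizing v with
  | zero => exact h hP
  | succ n ih => exact Filter.Eventually.mp hP (Filter.Eventually.mono h fun y h1 h2 => ih h2 h1)

theorem EventuallySum.of_forall {n : ℕ} {v : X} (h : ∀ x, P x) : EventuallySum l n P v := by
  induction n generalizing v with
  | zero => exact h v
  | succ n ih => exact Eventually.of_forall fun y => ih

theorem EventuallySum.mono {n : ℕ} {v : X} (hP : EventuallySum l n P v) (h : ∀ x, P x → Q x) :
    EventuallySum l n Q v :=
  hP.mp (.of_forall h)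

theorem EventuallySum.comap {l' : Filter Y} {P : Y → Prop} {T : X → Y}
    (hadd : ∀ x y, T (x + y) = T x + T y) (hT : Tendsto T l l') {n : ℕ} {v : X}
    (h : EventuallySum l' n P (T v)) : EventuallySum l n (fun x => P (T x)) v := by
  induction n generalizing v with
  | zero => exact h
  | succ n ih => exact (hT.eventually h).mono fun y hy => ih (by rwa [hadd])

theorem eventuallySum_norm_le {𝕜 X : Type*} [RCLike 𝕜] [NormedAddCommGroup X] [NormedSpace 𝕜 X]
    (n : ℕ) (v : X) : EventuallySum (weakNull 𝕜 X) n (fun x => ‖x‖ ≤ ‖v‖ + n) v := by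
  induction n generalizing v with
  | zero => exact (by simp : ‖v‖ ≤ ‖v‖ + (0 : ℕ))
  | succ n ih =>
    refine eventually_norm_le_weakNull.mono fun y hy => (ih (v + y)).mono fun x hx => ?_
    push_cast
    linarith [norm_add_le v y]

end EventuallySum

/-! ### Szlenk derivations and weakly null moves -/

section Szlenk

variable {𝕜 X : Type*} [RCLike 𝕜] [NormedAddCommGroup X] [NormedSpace 𝕜 X]
  {K : Set (WeakDual 𝕜 X)}

theorem szlenkDeriv_subset (ε : ℝ) (K : Set (WeakDual 𝕜 X)) : szlenkDeriv ε K ⊆ K :=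
  fun _ h => h.1

theorem foldr_szlenkDeriv_subset (εs : List ℝ) (K : Set (WeakDual 𝕜 X)) :
    εs.foldr szlenkDeriv K ⊆ K := by
  induction εs with
  | nil => exact subset_rfl
  | cons ε εs ih => exact (szlenkDeriv_subset _ _).trans ih

theorem isClosed_szlenkDeriv {ε : ℝ} (hK : IsClosed K) : IsClosed (szlenkDeriv ε K) := by
  rw [← isOpen_compl_iff, isOpen_iff_mem_nhds]
  intro f hf
  by_cases hfK : f ∈ K
  · obtain ⟨hε, V, hV, h⟩ : 0 < ε ∧ ∃ V ∈ 𝓝 f,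
        ¬ ENNReal.ofReal ε < Metric.ediam (WeakDual.toStrongDual '' (V ∩ K)) := by
      by_contra! hcon
      exact hf ⟨hfK, hcon⟩
    filter_upwards [eventually_mem_nhds_iff.2 hV] with g hg hg'
    exact h (hg'.2 hε V hg)
  · filter_upwards [hK.isOpen_compl.mem_nhds hfK] with g hg hg' using hg hg'.1

theorem isCompact_foldr_szlenkDeriv (hK : IsCompact K) (εs : List ℝ) :
    IsCompact (εs.foldr szlenkDeriv K) := by
  refine hK.of_isClosed_subset ?_ (foldr_szlenkDeriv_subset εs K)
  induction εs with
  | nil => exact hK.isClosed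
  | cons ε εs ih => exact isClosed_szlenkDeriv ih

theorem exists_norm_le_one_lt_re_apply {φ : StrongDual 𝕜 X} {r : ℝ} (hr : r < ‖φ‖) :
    ∃ x : X, ‖x‖ ≤ 1 ∧ r < RCLike.re (φ x) := by
  obtain ⟨x, hx, hφ⟩ := φ.exists_lt_apply_of_lt_opNorm hr
  obtain ⟨c, hc, h⟩ := RCLike.exists_norm_eq_mul_self (φ x)
  refine ⟨c • x, by rw [norm_smul, hc, one_mul]; exact hx.le, ?_⟩
  rw [map_smul, smul_eq_mul, ← h, RCLike.ofReal_re]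
  exact hφ

theorem exists_lt_norm_sub_of_mem_szlenkDeriv {ε : ℝ} (hε : 0 < ε) {f : WeakDual 𝕜 X}
    (hf : f ∈ szlenkDeriv ε K) {V : Set (WeakDual 𝕜 X)} (hV : V ∈ 𝓝 f) :
    ∃ g ∈ V ∩ K, ε / 2 < ‖WeakDual.toStrongDual (g - f)‖ := by
  by_contra! h
  refine (hf.2 hε V hV).not_ge (Metric.ediam_le ?_)
  rintro _ ⟨g₁, h₁, rfl⟩ _ ⟨g₂, h₂, rfl⟩
  rw [edist_dist]
  refine ENNReal.ofReal_le_ofReal ?_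
  have h1 := h g₁ h₁
  have h2 := h g₂ h₂
  rw [map_sub, ← dist_eq_norm] at h1 h2
  linarith [dist_triangle_right (WeakDual.toStrongDual g₁) (WeakDual.toStrongDual g₂)
    (WeakDual.toStrongDual f)]

/-- Near a point of `s_ε(K)`, a weakly null move gains `ε / 4`. Witnesses `x` of `‖g - f‖ > ε / 2`,
for `g ∈ K` close to `f`, need not be weakly null, but along an ultrafilter they are weakly Cauchy,
and half the difference of two of them is nearly weakly null. -/
theorem frequently_lt_re_of_mem_szlenkDeriv {ε : ℝ} {f : WeakDual 𝕜 X}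
    (hf : f ∈ szlenkDeriv ε K) (v : X) {η : ℝ} (hη : 0 < η) :
    ∃ᶠ y in weakNull 𝕜 X, ∃ g ∈ K, RCLike.re (f v) + ε / 4 - η < RCLike.re (g (v + y)) := by
  by_cases hε : 0 < ε
  swap
  · -- For `ε ≤ 0` the move `y = 0` suffices.
    refine Frequently.filter_mono (frequently_pure.2 ⟨f, hf.1, ?_⟩) pure_zero_le_weakNull
    rw [add_zero]
    linarith
  set S : Set (WeakDual 𝕜 X × X) :=
    {p | p.1 ∈ K ∧ ‖p.2‖ ≤ 1 ∧ ε / 2 < RCLike.re ((p.1 - f) p.2)}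
  have hne : (comap Prod.fst (𝓝 f) ⊓ 𝓟 S).NeBot := by
    refine inf_principal_neBot_iff.2 fun W hW => ?_
    obtain ⟨V, hV, hVW⟩ := hW
    obtain ⟨g, hg, hlt⟩ := exists_lt_norm_sub_of_mem_szlenkDeriv hε hf hV
    obtain ⟨x, hx, hgx⟩ := exists_norm_le_one_lt_re_apply hlt
    exact ⟨(g, x), hVW hg.1, hg.2, hx, hgx⟩
  set U := Ultrafilter.of (comap Prod.fst (𝓝 f) ⊓ 𝓟 S)
  have hU : (U : Filter (WeakDual 𝕜 X × X)) ≤ comap Prod.fst (𝓝 f) ⊓ 𝓟 S := Ultrafilter.of_le _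
  have hUS : ∀ᶠ p in (U : Filter (WeakDual 𝕜 X × X)), p ∈ S :=
    (hU.trans inf_le_right) (mem_principal_self S)
  have hUf : Tendsto Prod.fst (U : Filter (WeakDual 𝕜 X × X)) (𝓝 f) :=
    tendsto_iff_comap.2 (hU.trans inf_le_left)
  have heval (x : X) : Tendsto (fun p : WeakDual 𝕜 X × X => RCLike.re (p.1 x)) U
      (𝓝 (RCLike.re (f x))) :=
    (RCLike.continuous_re.tendsto _).comp (((WeakDual.eval_continuous x).tendsto f).comp hUf)
  -- `φ` converges along `U` for every functional `φ`, so half the differences are weakly null.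
  have hprod : Tendsto (fun q : (WeakDual 𝕜 X × X) × WeakDual 𝕜 X × X =>
      (2⁻¹ : 𝕜) • (q.2.2 - q.1.2)) ((U : Filter _).curry (U : Filter _)) (weakNull 𝕜 X) := by
    refine tendsto_weakNull_iff.2 ⟨fun φ => ?_, ?_⟩
    · obtain ⟨c, -, hc⟩ := (isCompact_closedBall (0 : 𝕜) ‖φ‖).ultrafilter_le_nhds
        (U.map fun p => φ p.2) (le_principal_iff.2 (hUS.mono fun p hp => by
          simpa using (φ.le_opNorm _).trans (mul_le_of_le_one_right (norm_nonneg _) hp.2.1)))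
      have hc' : Tendsto (fun p : WeakDual 𝕜 X × X => φ p.2) U (𝓝 c) := hc
      have := (((hc'.comp tendsto_snd).sub (hc'.comp tendsto_fst)).const_smul (2⁻¹ : 𝕜)).mono_left
        (curry_le_prod (l := (U : Filter (WeakDual 𝕜 X × X)))
          (m := (U : Filter (WeakDual 𝕜 X × X))))
      simpa using this
    · refine curry_le_prod (prod_mem_prod hUS hUS |> mem_of_superset <| ?_)
      rintro ⟨p, q⟩ ⟨hp, hq⟩
      have := norm_sub_le q.2 p.2
      have h2 : ‖(2⁻¹ : 𝕜)‖ = 2⁻¹ := by simp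
      simp only [Set.mem_ofPred_eq, norm_smul, h2]
      linarith [hp.2.1, hq.2.1]
  have : ((U : Filter (WeakDual 𝕜 X × X)).curry (U : Filter (WeakDual 𝕜 X × X))).NeBot := by
    refine ⟨fun h => ?_⟩
    have h' := eventually_curry_iff.1 ((eventually_false_iff_eq_bot).2 h)
    simp only [eventually_const] at h'
  refine hprod.frequently (Eventually.frequently ?_)
  have hfy := (RCLike.continuous_re.tendsto _).comp
    ((tendsto_apply_weakNull (WeakDual.toStrongDual f)).comp hprod)
  rw [map_zero] at hfy
  have hsmall := hfy.eventually (lt_mem_nhds (show -(η / 3) < 0 by linarith))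
  suffices ∀ᶠ q in (U : Filter (WeakDual 𝕜 X × X)).curry (U : Filter (WeakDual 𝕜 X × X)),
      q.2.1 ∈ K ∧ (-(η / 3) < RCLike.re (f ((2⁻¹ : 𝕜) • (q.2.2 - q.1.2))) →
      RCLike.re (f v) + ε / 4 - η < RCLike.re (q.2.1 (v + (2⁻¹ : 𝕜) • (q.2.2 - q.1.2)))) from
    (hsmall.and this).mono fun q hq => ⟨q.2.1, hq.2.1, hq.2.2 hq.1⟩
  -- With the first witness `p` fixed, the functional `q.1` of the second is weak* close to `f` at
  -- the points `v` and `p.2`.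
  rw [eventually_curry_iff]
  refine Eventually.of_forall fun p => ?_
  have hη3 : 0 < η / 3 := by linarith
  filter_upwards [hUS, (heval v).eventually (lt_mem_nhds (sub_lt_self _ hη3)),
    (heval p.2).eventually (gt_mem_nhds (lt_add_of_pos_right _ hη3))] with q hq hv hp
  refine ⟨hq.1, fun hf' => ?_⟩
  have hqx := hq.2.2
  have h2 (z : 𝕜) : RCLike.re ((2⁻¹ : 𝕜) * z) = 2⁻¹ * RCLike.re z := by
    rw [show (2⁻¹ : 𝕜) = ((2⁻¹ : ℝ) : 𝕜) by
      rw [RCLike.ofReal_inv, RCLike.ofReal_ofNat], RCLike.re_ofReal_mul]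
  have e1 : RCLike.re ((q.1 - f) q.2) = RCLike.re (q.1 q.2) - RCLike.re (f q.2) :=
    map_sub RCLike.re (q.1 q.2) (f q.2)
  simp only [map_add, map_smul, map_sub, smul_eq_mul, h2] at hf' ⊢
  rw [e1] at hqx
  linarith

/-- A point of `s_{ε₁} ⋯ s_{εₙ}(K)` yields frequently sums of moves on which some member of `K` has
real part at least about `(ε₁ + ⋯ + εₙ) / 4`. -/
theorem not_eventuallySum_of_mem_foldr_szlenkDeriv (εs : List ℝ) {f : WeakDual 𝕜 X}
    (hf : f ∈ εs.foldr szlenkDeriv K) {v : X} {c : ℝ} (hc : c < RCLike.re (f v)) :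
    ¬ EventuallySum (weakNull 𝕜 X) εs.length
      (fun x => ∀ g ∈ K, RCLike.re (g x) ≤ c + εs.sum / 4) v := by
  induction εs generalizing f v c with
  | nil => exact fun h => (h f hf).not_gt (by simpa using hc)
  | cons ε εs ih =>
    refine not_eventually.2 ((frequently_lt_re_of_mem_szlenkDeriv hf v
      (sub_pos.2 hc)).mono fun y hy => ?_)
    obtain ⟨g, hg, hlt⟩ := hy
    have := ih hg (v := v + y) (c := c + ε / 4) (by linarith)
    rwa [add_assoc, ← add_div, ← List.sum_cons] at this

theorem exists_finite_grid (a : ℝ) {δ : ℝ} (hδ : 0 < δ) :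
    ∃ G : Set ℝ, G.Finite ∧ ∀ r, |r| ≤ a → ∃ g ∈ G, g ≤ r ∧ r ≤ g + δ := by
  refine ⟨(fun k : ℤ => k * δ) '' Set.Icc ⌊-a / δ⌋ ⌊a / δ⌋, (Set.finite_Icc _ _).image _,
    fun r hr => ⟨_, ⟨⌊r / δ⌋, ⟨?_, ?_⟩, rfl⟩, ?_, ?_⟩⟩
  · exact Int.floor_mono (by gcongr; exact (abs_le.1 hr).1)
  · exact Int.floor_mono (by gcongr; exact (abs_le.1 hr).2)
  · exact (le_div_iff₀ hδ).1 (Int.floor_le _)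
  · have := (div_lt_iff₀ hδ).1 (Int.lt_floor_add_one (r / δ))
    dsimp only
    linarith

/-- If frequently along the moves `y` some `f ∈ S` satisfies `Re f(y) ≥ g`, then weak* limits of
such functionals lie in `s_{g - δ}(S)`: a limit is itself small on the weakly null `y`. -/
theorem exists_mem_szlenkDeriv_of_frequently {S : Set (WeakDual 𝕜 X)} (hS : IsCompact S)
    {g δ b : ℝ} (hδ : 0 < δ) {v : X} (h : ∃ᶠ y in weakNull 𝕜 X, ∃ f ∈ S,
      b ≤ RCLike.re (f v) ∧ g ≤ RCLike.re (f y)) :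
    ∃ f ∈ szlenkDeriv (g - δ) S, b ≤ RCLike.re (f v) := by
  set Q : Set X := {y | ∃ f ∈ S, b ≤ RCLike.re (f v) ∧ g ≤ RCLike.re (f y)}
  have hne : (weakNull 𝕜 X ⊓ 𝓟 Q).NeBot := frequently_mem_iff_neBot.1 h
  set U := Ultrafilter.of (weakNull 𝕜 X ⊓ 𝓟 Q)
  have hU : (U : Filter X) ≤ weakNull 𝕜 X ⊓ 𝓟 Q := Ultrafilter.of_le _
  have hUQ : ∀ᶠ y in (U : Filter X), y ∈ Q := (hU.trans inf_le_right) (mem_principal_self Q)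
  have hUw : (U : Filter X) ≤ weakNull 𝕜 X := hU.trans inf_le_left
  choose! F hF using fun y (hy : y ∈ Q) => hy
  obtain ⟨f, hfS, hf⟩ := hS.ultrafilter_le_nhds (U.map F)
    (le_principal_iff.2 (hUQ.mono fun y hy => (hF y hy).1))
  have hf' : Tendsto F U (𝓝 f) := hf
  refine ⟨f, ⟨hfS, fun hg V hV => ?_⟩, ?_⟩
  · have hsmall := ((RCLike.continuous_re.tendsto _).comp
      ((tendsto_apply_weakNull (WeakDual.toStrongDual f)).mono_left hUw)).eventually
      (gt_mem_nhds (show RCLike.re (0 : 𝕜) < δ by simpa using hδ))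
    obtain ⟨y, hyQ, hyV, hys, hy1⟩ := (hUQ.and ((hf'.eventually hV).and
      (hsmall.and (eventually_norm_le_weakNull.filter_mono hUw)))).exists
    have hy := hF y hyQ
    have hys' : RCLike.re (f y) < δ := hys
    have hle : ENNReal.ofReal ‖WeakDual.toStrongDual (F y) - WeakDual.toStrongDual f‖ ≤
        Metric.ediam (WeakDual.toStrongDual '' (V ∩ S)) := by
      rw [← dist_eq_norm, ← edist_dist]
      exact Metric.edist_le_ediam_of_mem ⟨F y, ⟨hyV, hy.1⟩, rfl⟩
        ⟨f, ⟨mem_of_mem_nhds hV, hfS⟩, rfl⟩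
    refine lt_of_lt_of_le ((ENNReal.ofReal_lt_ofReal_iff_of_nonneg hg.le).2 ?_) hle
    have h1 : ‖(WeakDual.toStrongDual (F y) - WeakDual.toStrongDual f) y‖ ≤
        ‖WeakDual.toStrongDual (F y) - WeakDual.toStrongDual f‖ :=
      (ContinuousLinearMap.le_opNorm _ _).trans (mul_le_of_le_one_right (norm_nonneg _) hy1)
    have h2 := RCLike.re_le_norm ((WeakDual.toStrongDual (F y) - WeakDual.toStrongDual f) y)
    have h3 : RCLike.re ((WeakDual.toStrongDual (F y) - WeakDual.toStrongDual f) y) =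
        RCLike.re (F y y) - RCLike.re (f y) := map_sub RCLike.re (F y y) (f y)
    linarith [hy.2.2]
  · have hv : Tendsto (fun y => RCLike.re (F y v)) U (𝓝 (RCLike.re (f v))) :=
      (RCLike.continuous_re.tendsto _).comp (((WeakDual.eval_continuous v).tendsto f).comp hf')
    exact ge_of_tendsto hv (hUQ.mono fun y hy => (hF y hy).2.1)

/-- If sums of `n` moves frequently exceed `s` on `K`, then some derived set
`s_{ε₁} ⋯ s_{εₙ}(K)` is nonempty with `ε₁ + ⋯ + εₙ` nearly `s`. The `εᵢ` are taken from a finite set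
fixed in advance, so that in each step one value occurs frequently. -/
theorem exists_mem_foldr_szlenkDeriv (hK : IsCompact K) {a : ℝ}
    (ha : ∀ f ∈ K, ∀ y, ‖y‖ ≤ 1 → |RCLike.re (f y)| ≤ a) {δ : ℝ} (hδ : 0 < δ) (n : ℕ) :
    ∃ E : Set (List ℝ), E.Finite ∧ ∀ v s, ¬ EventuallySum (weakNull 𝕜 X) n
      (fun x => ∀ f ∈ K, RCLike.re (f x) ≤ s) v →
      ∃ εs ∈ E, ∃ f ∈ εs.foldr szlenkDeriv K, s ≤ RCLike.re (f v) + εs.sum + 2 * n * δ := by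
  induction n with
  | zero =>
    refine ⟨{[]}, Set.finite_singleton _, fun v s h => ⟨[], rfl, ?_⟩⟩
    obtain ⟨f, hf, hlt⟩ : ∃ f ∈ K, s < RCLike.re (f v) := by
      by_contra! h'
      exact h h'
    exact ⟨f, hf, by simpa using hlt.le⟩
  | succ n ih =>
    obtain ⟨E, hE, ih⟩ := ih
    obtain ⟨G, hG, hgrid⟩ := exists_finite_grid a hδ
    refine ⟨Set.image2 (fun g l => (g - δ) :: l) G E, hG.image2 _ hE, fun v s h => ?_⟩
    have h1 : ∃ᶠ y in weakNull 𝕜 X, ∃ g ∈ G, ∃ εs ∈ E, ∃ f ∈ εs.foldr szlenkDeriv K,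
        s - (g + δ) - εs.sum - 2 * n * δ ≤ RCLike.re (f v) ∧ g ≤ RCLike.re (f y) := by
      refine ((not_eventually.1 h).and_eventually eventually_norm_le_weakNull).mono ?_
      rintro y ⟨hy, hy1⟩
      obtain ⟨εs, hεs, f, hf, hle⟩ := ih _ _ hy
      obtain ⟨g, hg, hg1, hg2⟩ := hgrid _ (ha f (foldr_szlenkDeriv_subset _ _ hf) y hy1)
      rw [map_add, map_add] at hle
      exact ⟨g, hg, εs, hεs, f, hf, by linarith, hg1⟩
    obtain ⟨g, hg, h2⟩ := hG.frequently_exists.1 h1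
    obtain ⟨εs, hεs, h3⟩ := hE.frequently_exists.1 h2
    obtain ⟨f, hf, hle⟩ := exists_mem_szlenkDeriv_of_frequently
      (isCompact_foldr_szlenkDeriv hK εs) hδ h3
    refine ⟨_, Set.mem_image2_of_mem hg hεs, f, hf, ?_⟩
    rw [List.sum_cons]
    push_cast
    linarith

/-- An `M`-summable Szlenk index bounds, for each `s > M`, the real parts of `K` on sums of weakly
null moves by `s`. -/
theorem HasSummableSzlenkWith.eventuallySum (hK : IsCompact K) {a : ℝ}
    (ha : ∀ f ∈ K, ∀ y, ‖y‖ ≤ 1 → |RCLike.re (f y)| ≤ a) {M s : ℝ}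
    (hM : HasSummableSzlenkWith M K) (hs : M < s) (n : ℕ) :
    EventuallySum (weakNull 𝕜 X) n (fun x => ∀ f ∈ K, RCLike.re (f x) ≤ s) 0 := by
  by_contra h
  have hpos : (0 : ℝ) < 2 * n + 1 := by positivity
  obtain ⟨E, -, hE⟩ := exists_mem_foldr_szlenkDeriv hK ha (div_pos (sub_pos.2 hs) hpos) n
  obtain ⟨εs, -, f, hf, hle⟩ := hE 0 s h
  have := hM εs ⟨f, hf⟩
  have h2 : 2 * n * ((s - M) / (2 * n + 1)) < s - M := by
    rw [mul_div_assoc', div_lt_iff₀ hpos]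
    nlinarith
  simp only [map_zero, zero_add] at hle
  linarith

theorem hasSummableSzlenkWith_of_eventuallySum {s : ℝ} (hs : 0 ≤ s)
    (h : ∀ n ≥ 1, EventuallySum (weakNull 𝕜 X) n (fun x => ∀ f ∈ K, RCLike.re (f x) ≤ s) 0) :
    HasSummableSzlenkWith (4 * s) K := by
  rintro (_ | ⟨ε, εs⟩) ⟨f, hf⟩
  · simpa using hs
  by_contra! hlt
  refine not_eventuallySum_of_mem_foldr_szlenkDeriv _ hf (v := 0)
    (c := s - (ε :: εs).sum / 4) (by simp only [map_zero]; linarith) ?_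
  simpa using h (ε :: εs).length (by simp)

end Szlenk

/-! ### Weakly null trees and iterated quantifiers -/

theorem sum_Icc_take_cons {D X : Type*} [AddCommMonoid X] (x : List D → X) (d : D) (t : List D)
    (n : ℕ) : ∑ i ∈ Finset.Icc 1 (n + 1), x ((d :: t).take i) =
      x [d] + ∑ i ∈ Finset.Icc 1 n, x (d :: t.take i) := by
  simp only [← Finset.Ico_add_one_right_eq_Icc, Finset.sum_Ico_eq_sum_range, add_tsub_cancel_right,
    Finset.sum_range_succ', add_zero, List.take_one, List.head?_cons, Option.toList_some]
  rw [add_comm]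
  congr 1

section Trees

variable {𝕜 : Type*} {X : Type u} [RCLike 𝕜] [NormedAddCommGroup X] [NormedSpace 𝕜 X]
  {P : X → Prop}

/-- A property that holds eventually for sums of weakly null moves holds on some branch of every
weakly null tree: pass down the tree, choosing each node far out in its net. -/
theorem EventuallySum.exists_branch {D : Type*} [Preorder D] [IsDirectedOrder D] [Nonempty D]
    {n : ℕ} {v : X} (h : EventuallySum (weakNull 𝕜 X) n P v) {x : List D → X}
    (hb : IsUnitBallTree n x) (hx : IsWeaklyNullTree 𝕜 n x) :
    ∃ t : List D, t.length = n ∧ P (v + ∑ i ∈ Finset.Icc 1 n, x (t.take i)) := by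
  induction n generalizing v x with
  | zero => exact ⟨[], rfl, by simpa [EventuallySum] using h⟩
  | succ n ih =>
    have htend : Tendsto (fun d : D => x [d]) atTop (weakNull 𝕜 X) :=
      tendsto_weakNull_iff.2 ⟨tendsto_toWeakSpace_zero_iff.1 (hx [] n.succ_pos),
        .of_forall fun d => hb [d] le_rfl (by simp)⟩
    obtain ⟨d, hd⟩ := (htend.eventually h).exists
    obtain ⟨t, ht, hP⟩ := ih (x := fun t => x (d :: t)) hd
      (fun t _ h2 => hb (d :: t) (by simp) (by simpa using h2))
      (fun t ht => hx (d :: t) (by simpa using ht))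
    refine ⟨d :: t, by simp [ht], ?_⟩
    rwa [sum_Icc_take_cons, ← add_assoc]

/-- The members of a filter, directed by reverse inclusion. -/
abbrev FilterIndex {X : Type*} (l : Filter X) := {S : Set X // S ∈ l}ᵒᵈ

instance {X : Type*} (l : Filter X) : IsDirectedOrder (FilterIndex l) :=
  ⟨fun a b => ⟨OrderDual.toDual ⟨a.ofDual.1 ∩ b.ofDual.1, inter_mem a.ofDual.2 b.ofDual.2⟩,
    (Set.inter_subset_left : a.ofDual.1 ∩ b.ofDual.1 ⊆ a.ofDual.1),
    (Set.inter_subset_right : a.ofDual.1 ∩ b.ofDual.1 ⊆ b.ofDual.1)⟩⟩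

instance {X : Type*} (l : Filter X) : Nonempty (FilterIndex l) :=
  ⟨OrderDual.toDual ⟨Set.univ, univ_mem⟩⟩

theorem tendsto_of_mem_filterIndex {X : Type*} {l : Filter X} {y : FilterIndex l → X}
    (hy : ∀ d : FilterIndex l, y d ∈ d.ofDual.1) : Tendsto y atTop l := by
  intro S hS
  refine mem_map.2 ((eventually_ge_atTop (OrderDual.toDual ⟨S, hS⟩ : FilterIndex l)).mono ?_)
  exact fun d hd => (show d.ofDual.1 ⊆ S from hd) (hy d)

/-- A property that does not hold eventually for sums of weakly null moves fails on all branches of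
some weakly null tree. The node at `t⌢d` is chosen in the member `d` of the filter `weakNull`. -/
theorem exists_tree_of_not_eventuallySum {n : ℕ} {v : X}
    (h : ¬ EventuallySum (weakNull 𝕜 X) n P v) :
    ∃ x : List (FilterIndex (weakNull 𝕜 X)) → X, IsUnitBallTree n x ∧ IsWeaklyNullTree 𝕜 n x ∧
      ∀ t : List (FilterIndex (weakNull 𝕜 X)), t.length = n →
        ¬ P (v + ∑ i ∈ Finset.Icc 1 n, x (t.take i)) := by
  induction n generalizing v with
  | zero => exact ⟨fun _ => 0, fun _ _ _ => by simp, fun _ ht => absurd ht (by simp),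
      fun t _ => by simpa [EventuallySum] using h⟩
  | succ n ih =>
    have hmove (d : FilterIndex (weakNull 𝕜 X)) : ∃ y ∈ d.ofDual.1, ‖y‖ ≤ 1 ∧
        ¬ EventuallySum (weakNull 𝕜 X) n P (v + y) := by
      obtain ⟨y, hy, hyd, hy1⟩ := ((not_eventually.1 h).and_eventually
        ((eventually_mem_set.2 d.ofDual.2).and eventually_norm_le_weakNull)).exists
      exact ⟨y, hyd, hy1, hy⟩
    choose y hyd hy1 hy using hmove
    choose z hzb hzn hz using fun d => ih (hy d)
    let x : List (FilterIndex (weakNull 𝕜 X)) → X := fun t => match t with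
      | [] => 0
      | [d] => y d
      | d :: e :: t => z d (e :: t)
    have hx (d) (t : List (FilterIndex (weakNull 𝕜 X))) (ht : 1 ≤ t.length) :
        x (d :: t) = z d t := by
      cases t with
      | nil => simp at ht
      | cons e t => rfl
    refine ⟨x, ?_, ?_, ?_⟩
    · rintro (_ | ⟨d, t⟩) h1 h2
      · simp at h1
      · rcases Nat.eq_zero_or_pos t.length with h0 | h0
        · rw [List.length_eq_zero_iff.1 h0]
          exact hy1 d
        · rw [hx d t h0]
          exact hzb d t h0 (by simpa using h2)
    · rintro (_ | ⟨d, t⟩) ht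
      · exact tendsto_toWeakSpace_zero_iff.2
          (tendsto_weakNull_iff.1 (tendsto_of_mem_filterIndex hyd)).1
      · refine (hzn d t (by simpa using ht)).congr fun e => ?_
        rw [List.cons_append, hx d _ (by simp)]
    · rintro (_ | ⟨d, t⟩) ht
      · simp at ht
      · have ht' : t.length = n := by simpa using ht
        rw [sum_Icc_take_cons, ← add_assoc]
        have hsum : ∑ i ∈ Finset.Icc 1 n, x (d :: t.take i) =
            ∑ i ∈ Finset.Icc 1 n, z d (t.take i) := by
          refine Finset.sum_congr rfl fun i hi => hx d _ ?_
          rw [Finset.mem_Icc] at hi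
          rw [List.length_take]
          omega
        rw [hsum]
        exact hz d t ht'

end Trees

/-! ### The quantity `Σ` of an operator -/

section Operator

variable {𝕜 : Type*} {X : Type u} {Y : Type*} [RCLike 𝕜] [NormedAddCommGroup X] [NormedSpace 𝕜 X]
  [NormedAddCommGroup Y] [NormedSpace 𝕜 Y]

theorem isGreatest_re_adjointBall (A : X →L[𝕜] Y) (x : X) :
    IsGreatest ((fun f : WeakDual 𝕜 X => RCLike.re (f x)) '' adjointBall A) ‖A x‖ := by
  constructor
  · obtain ⟨g, hg, hgx⟩ := exists_dual_vector'' 𝕜 (A x)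
    refine ⟨_, ⟨g, by simpa using hg, rfl⟩, ?_⟩
    have : RCLike.re (g (A x)) = ‖A x‖ := by rw [hgx, RCLike.ofReal_re]
    exact this
  · rintro _ ⟨_, ⟨g, hg, rfl⟩, rfl⟩
    exact (RCLike.re_le_norm (g (A x))).trans
      (g.le_of_opNorm_le_of_le (by simpa using hg) le_rfl |>.trans_eq (one_mul _))

theorem supportFn_adjointBall (A : X →L[𝕜] Y) (x : X) : supportFn (adjointBall A) x = ‖A x‖ :=
  (isGreatest_re_adjointBall A x).csSup_eq

theorem forall_re_le_adjointBall_iff (A : X →L[𝕜] Y) (x : X) (s : ℝ) :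
    (∀ f ∈ adjointBall A, RCLike.re (f x) ≤ s) ↔ ‖A x‖ ≤ s := by
  rw [isLUB_le_iff (isGreatest_re_adjointBall A x).isLUB, mem_upperBounds, Set.forall_mem_image]

theorem abs_re_le_of_mem_adjointBall {A : X →L[𝕜] Y} {f : WeakDual 𝕜 X} (hf : f ∈ adjointBall A)
    {y : X} (hy : ‖y‖ ≤ 1) : |RCLike.re (f y)| ≤ ‖A‖ := by
  obtain ⟨g, hg, rfl⟩ := hf
  have hg' : ‖g‖ ≤ 1 := by simpa using hg
  have h1 : ‖g (A y)‖ ≤ 1 * (‖A‖ * 1) :=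
    g.le_of_opNorm_le_of_le hg' (A.le_of_opNorm_le_of_le le_rfl hy)
  rw [one_mul, mul_one] at h1
  exact (RCLike.abs_re_le_norm (g (A y))).trans h1

theorem isCompact_adjointBall (A : X →L[𝕜] Y) : IsCompact (adjointBall A) := by
  have hcont : Continuous fun g : WeakDual 𝕜 Y =>
      StrongDual.toWeakDual ((WeakDual.toStrongDual g).comp A) :=
    WeakDual.continuous_of_continuous_eval fun x => WeakDual.eval_continuous (A x)
  exact (WeakDual.isCompact_closedBall (0 : StrongDual 𝕜 Y) 1).image hcont

/-- The iterated-quantifier form of `Σ_n(A) ≤ s`, up to arbitrarily small changes of `s`. -/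
def SumBound (A : X →L[𝕜] Y) (n : ℕ) (s : ℝ) : Prop :=
  EventuallySum (weakNull 𝕜 X) n (fun x => ‖A x‖ ≤ s) 0

theorem SumBound.sigmaN_le {A : X →L[𝕜] Y} {n : ℕ} {s : ℝ} (hs : 0 < s) (h : SumBound A n s) :
    sigmaN n (adjointBall A) ≤ ENNReal.ofReal s := by
  refine sInf_le ⟨s, hs, rfl, fun D _ _ _ x hb hx => ?_⟩
  obtain ⟨t, ht, hle⟩ := h.exists_branch hb hx
  simp only [supportFn_adjointBall]
  refine ciInf_le_of_le ⟨0, ?_⟩ ⟨t, ht⟩ (by simpa using hle)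
  rintro _ ⟨t, rfl⟩
  exact norm_nonneg _

theorem sumBound_of_sigmaN_lt {A : X →L[𝕜] Y} {n : ℕ} {s : ℝ}
    (h : sigmaN n (adjointBall A) < ENNReal.ofReal s) : SumBound A n s := by
  obtain ⟨_, ⟨s', -, rfl, hs'⟩, hlt⟩ := sInf_lt_iff.1 h
  by_contra hcon
  obtain ⟨x, hb, hx, hbig⟩ := exists_tree_of_not_eventuallySum hcon
  have hinf := hs' _ x hb hx
  have : Nonempty {t : List (FilterIndex (weakNull 𝕜 X)) // t.length = n} :=
    ⟨⟨List.replicate n (Classical.arbitrary _), by simp⟩⟩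
  have hle : s ≤ s' := (le_ciInf fun t => ?_).trans hinf
  · exact (ENNReal.ofReal_le_ofReal hle).not_gt hlt
  · rw [supportFn_adjointBall]
    simpa using (not_le.1 (hbig t.1 t.2)).le

theorem sigma_le_ofReal_iff {A : X →L[𝕜] Y} {c : ℝ} (hc : 0 ≤ c) :
    sigma (adjointBall A) ≤ ENNReal.ofReal c ↔ ∀ n ≥ 1, ∀ s > c, SumBound A n s := by
  constructor
  · intro h n hn s hs
    refine sumBound_of_sigmaN_lt (lt_of_le_of_lt ?_
      ((ENNReal.ofReal_lt_ofReal_iff (hc.trans_lt hs)).2 hs))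
    exact (le_iSup₂ (f := fun n (_ : 1 ≤ n) => sigmaN n (adjointBall A)) n hn).trans h
  · intro h
    refine iSup₂_le fun n hn => ENNReal.le_of_forall_pos_le_add fun ε hε _ => ?_
    have hε' : (0 : ℝ) < ε := hε
    rw [← ENNReal.ofReal_coe_nnreal, ← ENNReal.ofReal_add hc hε'.le]
    exact (h n hn _ (by linarith)).sigmaN_le (by linarith)

theorem SumBound.mono {A : X →L[𝕜] Y} {n : ℕ} {s s' : ℝ} (h : SumBound A n s) (hs : s ≤ s') :
    SumBound A n s' :=
  EventuallySum.mono h fun _ hx => hx.trans hs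

theorem SumBound.add {A B : X →L[𝕜] Y} {n : ℕ} {s s' : ℝ} (hA : SumBound A n s)
    (hB : SumBound B n s') : SumBound (A + B) n (s + s') :=
  EventuallySum.mp hA (EventuallySum.mono hB fun _ hb ha => norm_add_le_of_le ha hb)

theorem sumBound_nat_mul_norm (A : X →L[𝕜] Y) (n : ℕ) : SumBound A n (‖A‖ * n) :=
  (eventuallySum_norm_le n 0).mono fun _ hx => A.le_of_opNorm_le_of_le le_rfl (by simpa using hx)

/-- The operators with summable Szlenk index are those with `Σ(A) < ∞`. -/
theorem hasSummableSzlenk_adjointBall_iff (A : X →L[𝕜] Y) :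
    HasSummableSzlenk (adjointBall A) ↔ sigma (adjointBall A) < ∞ := by
  constructor
  · rintro ⟨M, hM0, hM⟩
    refine lt_of_le_of_lt ((sigma_le_ofReal_iff hM0).2 fun n _ s hs => ?_) ENNReal.ofReal_lt_top
    exact (hM.eventuallySum (isCompact_adjointBall A)
      (fun f hf y hy => abs_re_le_of_mem_adjointBall hf hy) hs n).mono
      fun x => (forall_re_le_adjointBall_iff A x s).1
  · intro h
    have hle := (sigma_le_ofReal_iff (A := A) ENNReal.toReal_nonneg).1
      (ENNReal.ofReal_toReal h.ne).ge
    have hpos : 0 ≤ (sigma (adjointBall A)).toReal + 1 := by positivity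
    refine ⟨4 * ((sigma (adjointBall A)).toReal + 1), by positivity,
      hasSummableSzlenkWith_of_eventuallySum hpos fun n hn => ?_⟩
    exact EventuallySum.mono (hle n hn _ (lt_add_one _)) fun x =>
      (forall_re_le_adjointBall_iff A x _).2

theorem sigma_add_le (A B : X →L[𝕜] Y) :
    sigma (adjointBall (A + B)) ≤ sigma (adjointBall A) + sigma (adjointBall B) := by
  rcases eq_or_ne (sigma (adjointBall A)) ∞ with hA | hA
  · simp [hA]
  rcases eq_or_ne (sigma (adjointBall B)) ∞ with hB | hB
  · simp [hB]
  have h1 := (sigma_le_ofReal_iff ENNReal.toReal_nonneg).1 (ENNReal.ofReal_toReal hA).ge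
  have h2 := (sigma_le_ofReal_iff ENNReal.toReal_nonneg).1 (ENNReal.ofReal_toReal hB).ge
  rw [← ENNReal.ofReal_toReal hA, ← ENNReal.ofReal_toReal hB,
    ← ENNReal.ofReal_add ENNReal.toReal_nonneg ENNReal.toReal_nonneg,
    sigma_le_ofReal_iff (by positivity)]
  intro n hn s hs
  set δ := (s - ((sigma (adjointBall A)).toReal + (sigma (adjointBall B)).toReal)) / 2 with hδ
  have hδ0 : 0 < δ := half_pos (sub_pos.2 hs)
  exact ((h1 n hn _ (lt_add_of_pos_right _ hδ0)).add (h2 n hn _ (lt_add_of_pos_right _ hδ0))).mono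
    (by rw [hδ]; linarith)

/-- If `T` has norm at most one, it maps weakly null moves to weakly null moves, so a domination of
`B` by `A ∘ T` bounds `Σ(B)`. -/
theorem sigma_le_mul_of_norm_le {W : Type u} {Z : Type*} [NormedAddCommGroup W] [NormedSpace 𝕜 W]
    [NormedAddCommGroup Z] [NormedSpace 𝕜 Z] {A : X →L[𝕜] Y} {B : W →L[𝕜] Z} {T : W →L[𝕜] X}
    (hA : sigma (adjointBall A) ≠ ∞) (hT : ‖T‖ ≤ 1) {k : ℝ} (hk : 0 ≤ k)
    (h : ∀ w, ‖B w‖ ≤ k * ‖A (T w)‖) :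
    sigma (adjointBall B) ≤ ENNReal.ofReal k * sigma (adjointBall A) := by
  have h1 := (sigma_le_ofReal_iff ENNReal.toReal_nonneg).1 (ENNReal.ofReal_toReal hA).ge
  have h2 (n) (hn : n ≥ 1) (s) (hs : s > (sigma (adjointBall A)).toReal) :
      SumBound B n (k * s) := by
    have h3 : EventuallySum (weakNull 𝕜 X) n (fun x => ‖A x‖ ≤ s) (T 0) := by
      rw [map_zero]
      exact h1 n hn s hs
    exact (h3.comap (map_add T) (tendsto_weakNull_of_norm_le_one hT)).mono fun w hw =>
      (h w).trans (by gcongr)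
  rw [← ENNReal.ofReal_toReal hA, ← ENNReal.ofReal_mul hk, sigma_le_ofReal_iff (by positivity)]
  intro n hn s hs
  rcases hk.eq_or_lt with rfl | hk
  · exact (h2 n hn _ (lt_add_one _)).mono (by rw [zero_mul] at hs ⊢; exact hs.le)
  · exact (h2 n hn (s / k) (by rwa [gt_iff_lt, lt_div_iff₀ hk, mul_comm])).mono
      (mul_div_cancel₀ _ hk.ne').le

/-- Rank-one operators do not contribute to `Σ`: they send weakly null nets to norm null nets. -/
theorem sigma_smulRight (f : StrongDual 𝕜 X) (y : Y) :
    sigma (adjointBall (ContinuousLinearMap.smulRight f y)) = 0 := by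
  have key (n : ℕ) {r : ℝ} (v : X) (hv : ‖f v‖ < r) :
      EventuallySum (weakNull 𝕜 X) n (fun x => ‖f x‖ < r) v := by
    induction n generalizing v with
    | zero => exact hv
    | succ n ih =>
      have h : Tendsto (fun y => ‖f (v + y)‖) (weakNull 𝕜 X) (𝓝 ‖f v‖) := by
        simpa only [map_add, add_zero] using ((tendsto_apply_weakNull f).const_add (f v)).norm
      exact (h.eventually (gt_mem_nhds hv)).mono fun y hy => ih _ hy
  rw [← nonpos_iff_eq_zero, ← ENNReal.ofReal_zero, sigma_le_ofReal_iff le_rfl]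
  intro n _ s hs
  have hpos : 0 < ‖y‖ + 1 := by positivity
  refine (key n (r := s / (‖y‖ + 1)) 0 (by rw [map_zero, norm_zero]; positivity)).mono
    fun x hx => ?_
  rw [ContinuousLinearMap.smulRight_apply, norm_smul]
  calc ‖f x‖ * ‖y‖ ≤ s / (‖y‖ + 1) * (‖y‖ + 1) := by gcongr; linarith
    _ = s := div_mul_cancel₀ _ hpos.ne'

/-- `Σ` is lower semicontinuous for the operator norm. -/
theorem sigma_le_of_tendsto {A : ℕ → X →L[𝕜] Y} {B : X →L[𝕜] Y} (hA : Tendsto A atTop (𝓝 B))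
    {c : ℝ≥0∞} (h : ∀ᶠ j in atTop, sigma (adjointBall (A j)) ≤ c) : sigma (adjointBall B) ≤ c := by
  rcases eq_or_ne c ∞ with rfl | hc
  · exact le_top
  rw [← ENNReal.ofReal_toReal hc] at h ⊢
  rw [sigma_le_ofReal_iff ENNReal.toReal_nonneg]
  intro n hn s hs
  have hlim : Tendsto (fun j => ‖B - A j‖ * n) atTop (𝓝 0) := by
    simpa using ((tendsto_const_nhds (x := B)).sub hA).norm.mul_const (n : ℝ)
  obtain ⟨j, hj, hjn⟩ := (h.and (hlim.eventually
    (gt_mem_nhds (show 0 < (s - c.toReal) / 2 by linarith)))).exists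
  have h1 := (sigma_le_ofReal_iff ENNReal.toReal_nonneg).1 hj n hn
    (c.toReal + (s - c.toReal) / 2) (by linarith)
  simpa using (h1.add (sumBound_nat_mul_norm (B - A j) n)).mono (s' := s) (by linarith)

end Operator

/-! ### The ideal properties -/

section BanachIdeal

variable {𝕜 : Type} [RCLike 𝕜]

theorem sigma_comp_le {W X Y Z : Type u}
    [NormedAddCommGroup W] [NormedSpace 𝕜 W] [NormedAddCommGroup X] [NormedSpace 𝕜 X]
    [NormedAddCommGroup Y] [NormedSpace 𝕜 Y] [NormedAddCommGroup Z] [NormedSpace 𝕜 Z]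
    (C : W →L[𝕜] X) (B : X →L[𝕜] Y) (A : Y →L[𝕜] Z) (hB : sigma (adjointBall B) ≠ ∞) :
    sigma (adjointBall (A ∘L B ∘L C)) ≤ ‖A‖ₑ * sigma (adjointBall B) * ‖C‖ₑ := by
  -- For `C = 0` the scalar `‖C‖⁻¹` is `0`, and `C = ‖C‖ • T` holds all the same.
  set T : W →L[𝕜] X := ((‖C‖⁻¹ : ℝ) : 𝕜) • C with hT
  have hT1 : ‖T‖ ≤ 1 := by
    rw [hT, norm_smul, RCLike.norm_ofReal, abs_of_nonneg (by positivity)]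
    exact inv_mul_le_one
  have hCT (w : W) : C w = (‖C‖ : 𝕜) • T w := by
    rcases eq_or_ne ‖C‖ 0 with h0 | h0
    · simp [norm_eq_zero.1 h0]
    · rw [hT, smul_apply, smul_smul, ← RCLike.ofReal_mul, mul_inv_cancel₀ h0,
        RCLike.ofReal_one, one_smul]
  refine (sigma_le_mul_of_norm_le hB hT1 (k := ‖A‖ * ‖C‖) (by positivity) fun w => ?_).trans_eq ?_
  · rw [ContinuousLinearMap.comp_apply, ContinuousLinearMap.comp_apply, hCT, map_smul, map_smul,
      norm_smul, RCLike.norm_ofReal, abs_norm, mul_comm ‖A‖, mul_assoc]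
    gcongr
    exact A.le_opNorm _
  · rw [ENNReal.ofReal_mul (norm_nonneg _), ofReal_norm, ofReal_norm]
    ring

theorem sigma_smul_le {X Y : Type u}
    [NormedAddCommGroup X] [NormedSpace 𝕜 X] [NormedAddCommGroup Y] [NormedSpace 𝕜 Y]
    (c : 𝕜) (A : X →L[𝕜] Y) (hA : sigma (adjointBall A) ≠ ∞) :
    sigma (adjointBall (c • A)) ≤ ‖c‖ₑ * sigma (adjointBall A) := by
  rw [← ofReal_norm c]
  refine sigma_le_mul_of_norm_le hA (T := .id 𝕜 X) ContinuousLinearMap.norm_id_le (norm_nonneg c)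
    fun x => ?_
  rw [smul_apply, norm_smul, ContinuousLinearMap.id_apply]

theorem sigma_zero {X Y : Type u}
    [NormedAddCommGroup X] [NormedSpace 𝕜 X] [NormedAddCommGroup Y] [NormedSpace 𝕜 Y] :
    sigma (adjointBall (0 : X →L[𝕜] Y)) = 0 := by
  rw [← sigma_smulRight (0 : StrongDual 𝕜 X) (0 : Y)]
  congr 2
  ext
  simp

theorem sigma_neg_ne_top {X Y : Type u}
    [NormedAddCommGroup X] [NormedSpace 𝕜 X] [NormedAddCommGroup Y] [NormedSpace 𝕜 Y]
    {A : X →L[𝕜] Y} (hA : sigma (adjointBall A) ≠ ∞) : sigma (adjointBall (-A)) ≠ ∞ := by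
  have := sigma_smul_le (-1 : 𝕜) A hA
  rw [neg_one_smul] at this
  exact ne_top_of_le_ne_top (ENNReal.mul_ne_top enorm_ne_top hA) this

section Components

variable {X Y : Type u} [NormedAddCommGroup X] [NormedSpace 𝕜 X] [CompleteSpace X]
  [NormedAddCommGroup Y] [NormedSpace 𝕜 Y] [CompleteSpace Y]

theorem mem_summableSzlenkClass_iff {A : X →L[𝕜] Y} :
    A ∈ summableSzlenkClass 𝕜 X Y ↔ sigma (adjointBall A) ≠ ∞ :=
  (hasSummableSzlenk_adjointBall_iff A).trans lt_top_iff_ne_top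

theorem sNorm_smul_le (c : 𝕜) {A : X →L[𝕜] Y} (hA : sigma (adjointBall A) ≠ ∞) :
    sNorm 𝕜 X Y (c • A) ≤ ‖c‖ₑ * sNorm 𝕜 X Y A := by
  rw [sNorm, sNorm, mul_add, enorm_smul]
  gcongr
  exact sigma_smul_le c A hA

theorem sNorm_smul (c : 𝕜) {A : X →L[𝕜] Y} (hA : sigma (adjointBall A) ≠ ∞) :
    sNorm 𝕜 X Y (c • A) = ‖c‖ₑ * sNorm 𝕜 X Y A := by
  refine (sNorm_smul_le c hA).antisymm ?_
  rcases eq_or_ne c 0 with rfl | hc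
  · simp
  have hcA : sigma (adjointBall (c • A)) ≠ ∞ :=
    ne_top_of_le_ne_top (ENNReal.mul_ne_top enorm_ne_top hA) (sigma_smul_le c A hA)
  have h := sNorm_smul_le c⁻¹ hcA
  rw [inv_smul_smul₀ hc] at h
  calc ‖c‖ₑ * sNorm 𝕜 X Y A ≤ ‖c‖ₑ * (‖c⁻¹‖ₑ * sNorm 𝕜 X Y (c • A)) := by gcongr
    _ = sNorm 𝕜 X Y (c • A) := by
      rw [← mul_assoc, ← enorm_mul, mul_inv_cancel₀ hc, enorm_one, one_mul]

/-- Completeness: the limit in operator norm is also the limit for `𝔰`, as `Σ` is lower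
semicontinuous for the operator norm. -/
theorem exists_tendsto_sNorm_of_cauchy {A : ℕ → X →L[𝕜] Y}
    (hA : ∀ k, A k ∈ summableSzlenkClass 𝕜 X Y)
    (hcauchy : ∀ δ : ℝ≥0∞, 0 < δ → ∃ N : ℕ, ∀ j ≥ N, ∀ k ≥ N, sNorm 𝕜 X Y (A j - A k) < δ) :
    ∃ B ∈ summableSzlenkClass 𝕜 X Y, Tendsto (fun k => sNorm 𝕜 X Y (A k - B)) atTop (𝓝 0) := by
  have hA' : CauchySeq A := by
    refine EMetric.cauchySeq_iff.2 fun δ hδ => ?_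
    obtain ⟨N, hN⟩ := hcauchy δ hδ
    refine ⟨N, fun j hj k hk => ?_⟩
    rw [edist_eq_enorm_sub]
    exact (le_add_right le_rfl).trans_lt (hN j hj k hk)
  obtain ⟨B, hB⟩ := cauchySeq_tendsto_of_complete hA'
  have hlim (k : ℕ) : Tendsto (fun j => A k - A j) atTop (𝓝 (A k - B)) :=
    tendsto_const_nhds.sub hB
  have key (δ : ℝ≥0∞) (hδ : 0 < δ) : ∃ N, ∀ k ≥ N, sNorm 𝕜 X Y (A k - B) ≤ δ + δ := by
    obtain ⟨N, hN⟩ := hcauchy δ hδ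
    refine ⟨N, fun k hk => add_le_add ?_ ?_⟩
    · exact le_of_tendsto (hlim k).enorm ((eventually_ge_atTop N).mono fun j hj =>
        (le_add_right le_rfl).trans (hN k hk j hj).le)
    · exact sigma_le_of_tendsto (hlim k) ((eventually_ge_atTop N).mono fun j hj =>
        (le_add_left le_rfl).trans (hN k hk j hj).le)
  refine ⟨B, ?_, ENNReal.tendsto_atTop_zero.2 fun ε hε => ?_⟩
  · obtain ⟨N, hN⟩ := key 1 one_pos
    have h1 : sigma (adjointBall (A N - B)) ≠ ∞ :=
      ne_top_of_le_ne_top (by simp) ((le_add_left le_rfl).trans (hN N le_rfl))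
    have h2 : B = A N + -(A N - B) := by abel
    rw [mem_summableSzlenkClass_iff, h2]
    exact ne_top_of_le_ne_top (ENNReal.add_ne_top.2
      ⟨mem_summableSzlenkClass_iff.1 (hA N), sigma_neg_ne_top h1⟩) (sigma_add_le _ _)
  · obtain ⟨N, hN⟩ := key (ε / 2) (ENNReal.half_pos hε.ne')
    exact ⟨N, fun k hk => (hN k hk).trans_eq (ENNReal.add_halves ε)⟩

end Components

theorem isOperatorIdeal_summableSzlenkClass : IsOperatorIdeal (summableSzlenkClass.{u} 𝕜) where
  comp_mem W X Y Z _ _ _ _ _ _ _ _ _ _ _ _ C B A hB := by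
    rw [mem_summableSzlenkClass_iff] at hB ⊢
    exact ne_top_of_le_ne_top (by finiteness) (sigma_comp_le C B A hB)
  id_mem := by
    have : ContinuousLinearMap.id 𝕜 (ULift.{u} 𝕜) = ContinuousLinearMap.smulRight
        (ContinuousLinearEquiv.ulift : ULift.{u} 𝕜 ≃L[𝕜] 𝕜).toContinuousLinearMap
        (ULift.up (1 : 𝕜)) := by
      ext x
      exact (mul_one x.down).symm
    rw [mem_summableSzlenkClass_iff, this, sigma_smulRight]
    exact ENNReal.zero_ne_top
  zero_mem X Y _ _ _ _ _ _ := by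
    rw [mem_summableSzlenkClass_iff, sigma_zero]
    exact ENNReal.zero_ne_top
  add_mem X Y _ _ _ _ _ _ A B hA hB := by
    rw [mem_summableSzlenkClass_iff] at hA hB ⊢
    exact ne_top_of_le_ne_top (by finiteness) (sigma_add_le A B)
  smul_mem X Y _ _ _ _ _ _ c A hA := by
    rw [mem_summableSzlenkClass_iff] at hA ⊢
    exact ne_top_of_le_ne_top (by finiteness) (sigma_smul_le c A hA)

theorem isIdealNorm_sNorm :
    IsIdealNorm (summableSzlenkClass.{u} 𝕜) (sNorm.{u} 𝕜) where
  lt_top X Y _ _ _ _ _ _ A hA :=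
    ENNReal.add_lt_top.2 ⟨enorm_lt_top, (mem_summableSzlenkClass_iff.1 hA).lt_top⟩
  eq_zero_iff X Y _ _ _ _ _ _ A hA := by
    refine ⟨fun h => norm_le_zero_iff.1 (ENNReal.ofReal_eq_zero.1 ?_), ?_⟩
    · rw [ofReal_norm]
      exact (add_eq_zero.1 h).1
    · rintro rfl
      rw [sNorm, sigma_zero, add_zero, ← ofReal_norm, norm_zero, ENNReal.ofReal_zero]
  add_le X Y _ _ _ _ _ _ A B hA hB :=
    (add_le_add (enorm_add_le A B) (sigma_add_le A B)).trans_eq (add_add_add_comm _ _ _ _)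
  smul_eq X Y _ _ _ _ _ _ c A hA := sNorm_smul c (mem_summableSzlenkClass_iff.1 hA)
  comp_le W X Y Z _ _ _ _ _ _ _ _ _ _ _ _ C B A hB := by
    rw [sNorm, sNorm, mul_add, add_mul]
    refine add_le_add ?_ (sigma_comp_le C B A (mem_summableSzlenkClass_iff.1 hB))
    rw [mul_assoc, ← ofReal_norm, ← ofReal_norm A, ← ofReal_norm B, ← ofReal_norm C,
      ← ENNReal.ofReal_mul (norm_nonneg _), ← ENNReal.ofReal_mul (norm_nonneg _)]
    refine ENNReal.ofReal_le_ofReal ((A.opNorm_comp_le _).trans ?_)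
    gcongr
    exact B.opNorm_comp_le C
  rankOne X Y _ _ _ _ _ _ f y := by
    rw [sNorm, sigma_smulRight, add_zero, ← ofReal_norm, ← ofReal_norm f, ← ofReal_norm y,
      ← ENNReal.ofReal_mul (norm_nonneg _), ContinuousLinearMap.norm_smulRight_apply]

end BanachIdeal

theorem mainTheorem5 (𝕜 : Type) [RCLike 𝕜] :
    IsBanachIdeal (summableSzlenkClass.{u} 𝕜) (sNorm.{u} 𝕜) where
  isOperatorIdeal := isOperatorIdeal_summableSzlenkClass
  isIdealNorm := isIdealNorm_sNorm
  complete _ _ _ _ _ _ _ _ _ hA hcauchy := exists_tendsto_sNorm_of_cauchy hA hcauchy
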